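/- Let $G$ be an abelian group and $n\ge 1$. For a space $X$ let $H^{k}(X;G)$ denote the \v{C}ech cohomology group of $X$ with coefficients in $G$ (the direct limit, over the open covers of $X$, of the cohomology groups of their nerves), reduced in dimension $k=0$, and for $B\subset X$ let $H^{k}(X,B;G)$ denote the usual relative \v{C}ech cohomology group of the pair $(X,B)$; in particular $H^{0}(X,\varnothing;G)$ is the unreduced group. For $A\subset B$, an element $\gamma\in H^{k}(A;G)$ is called extendable over $B$ if it lies in the image of the homomorphism $H^{k}(B;G)\to H^{k}(A;G)$ induced by the inclusion $A\hookrightarrow B$. Proposition 2.3. Let $A\subset K$ be compact subsets of a metrizable space and let $\gamma$ be a nontrivial element of $H^{n-1}(A;G)$. Suppose that there are closed subsets $P_1,P_2$ of $K$ such that - $P_1\cup P_2=K$ and $C=P_1\cap P_2$ is nonempty; - $\gamma$ is extendable over $P_i\cup A$ for each $i=1,2$, but $\gamma$ is not extendable over $K$. Then $H^{n-1}(C,C\cap A;G)\neq 0$. -/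

import Mathlib

open Set Topology

noncomputable section

namespace Cech

universe u v w

/-! ### Open covers and their nerves -/

/-- An open cover of `X` indexed by the points of `X`: an assignment of an open neighbourhood
`U x` to every point `x`.  Every open cover of `X` is refined by such a cover (choose for each `x`
a member of the cover that contains `x`), so these covers are cofinal among all open covers of `X`,
and the direct limit over them is the direct limit over all open covers.  Likewise for a pair
`(X, A)` the subfamily `(U a)` with `a ∈ A` covers `A`, and every open cover of the pair is refined
by one of this form. -/
structure Cover (X : Type u) [TopologicalSpace X] where
  /-- the member of the cover with index `x` -/
  nhd : X → Set X
  isOpen_nhd : ∀ x, IsOpen (nhd x)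
  mem_nhd : ∀ x, x ∈ nhd x

section Cover

variable {X : Type u} [TopologicalSpace X] {Y : Type v} [TopologicalSpace Y]

/-- `U ≤ V` means that `V` refines `U`, the identity of the index set being a refinement map. -/
instance : Preorder (Cover X) where
  le U V := ∀ x, V.nhd x ⊆ U.nhd x
  le_refl _ _ := Subset.rfl
  le_trans _ _ _ h h' x := (h' x).trans (h x)

instance : Nonempty (Cover X) :=
  ⟨⟨fun _ => univ, fun _ => isOpen_univ, fun _ => mem_univ _⟩⟩

instance : IsDirectedOrder (Cover X) :=
  ⟨fun U V => ⟨⟨fun x => U.nhd x ∩ V.nhd x, fun x => (U.isOpen_nhd x).inter (V.isOpen_nhd x),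
    fun x => ⟨U.mem_nhd x, V.mem_nhd x⟩⟩, fun _ => inter_subset_left, fun _ => inter_subset_right⟩⟩

instance : DecidableEq (Cover X) := Classical.decEq _

/-- The inverse image of a cover under a continuous map. -/
def Cover.comap (f : C(X, Y)) (U : Cover Y) : Cover X where
  nhd x := f ⁻¹' U.nhd (f x)
  isOpen_nhd x := (U.isOpen_nhd (f x)).preimage f.continuous
  mem_nhd x := U.mem_nhd (f x)

/-- The ordered `n`-simplices of the nerve of `U`: the `(n+1)`-tuples of indices for which the
corresponding members of `U` have a common point. -/
def Simplex (U : Cover X) (n : ℕ) : Type u :=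
  {s : Fin (n + 1) → X // (⋂ i, U.nhd (s i)).Nonempty}

/-- The `i`-th face of a simplex: omit the `i`-th vertex. -/
def Simplex.face {U : Cover X} {n : ℕ} (s : Simplex U (n + 1)) (i : Fin (n + 2)) : Simplex U n :=
  ⟨fun j => s.1 (i.succAbove j), s.2.mono fun _ hx =>
    mem_iInter.2 fun j => mem_iInter.1 hx (i.succAbove j)⟩

/-- The simplices of the nerve over `A`, that is, of the nerve of the cover of `A`
by the sets `U a ∩ A` with `a ∈ A`. -/
def Simplex.IsOver {U : Cover X} {n : ℕ} (A : Set X) (s : Simplex U n) : Prop :=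
  (∀ i, s.1 i ∈ A) ∧ ((⋂ i, U.nhd (s.1 i)) ∩ A).Nonempty

/-- The simplicial map of nerves induced by `f`, when the cover `V` refines `f⁻¹ U`. -/
def Simplex.map {U : Cover Y} {V : Cover X} (f : C(X, Y)) (h : U.comap f ≤ V) {n : ℕ}
    (s : Simplex V n) : Simplex U n :=
  ⟨fun i => f (s.1 i), s.2.elim fun x hx => ⟨f x, mem_iInter.2 fun i =>
    h (s.1 i) (mem_iInter.1 hx i)⟩⟩

end Cover

/-! ### Cochains of the nerve -/

section Cochains

variable {X : Type u} [TopologicalSpace X] {Y : Type v} [TopologicalSpace Y]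

/-- Ordered `n`-cochains of the nerve of `U` with coefficients in `G`. -/
abbrev Cochain (U : Cover X) (G : Type w) (n : ℕ) : Type (max u w) := Simplex U n → G

variable {G : Type w} [AddCommGroup G]

/-- The coboundary `(d c)(s) = ∑ i, (-1)^i c(i-th face of s)`. -/
def d (U : Cover X) (G : Type w) [AddCommGroup G] (n : ℕ) :
    Cochain U G n →+ Cochain U G (n + 1) where
  toFun c s := ∑ i : Fin (n + 2), (-1 : ℤ) ^ (i : ℕ) • c (s.face i)
  map_zero' := by ext; simp
  map_add' c c' := by ext; simp [Finset.sum_add_distrib]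

/-- The map of cochains induced by the simplicial map of nerves. -/
def pullback {U : Cover Y} {V : Cover X} (f : C(X, Y)) (h : U.comap f ≤ V) (G : Type w)
    [AddCommGroup G] (n : ℕ) : Cochain U G n →+ Cochain V G n where
  toFun c s := c (s.map f h)
  map_zero' := rfl
  map_add' _ _ := rfl

lemma d_pullback {U : Cover Y} {V : Cover X} (f : C(X, Y)) (h : U.comap f ≤ V) (n : ℕ)
    (c : Cochain U G n) : d V G n (pullback f h G n c) = pullback f h G (n + 1) (d U G n c) := rfl

/-- The relative cochains: those that vanish on the simplices over `A`. -/
def relCochains (U : Cover X) (A : Set X) (G : Type w) [AddCommGroup G] (n : ℕ) :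
    AddSubgroup (Cochain U G n) where
  carrier := {c | ∀ s : Simplex U n, s.IsOver A → c s = 0}
  zero_mem' _ _ := rfl
  add_mem' h h' s hs := by simp [h s hs, h' s hs]
  neg_mem' h s hs := by simp [h s hs]

/-- The relative cocycles. -/
def relCocycles (U : Cover X) (A : Set X) (G : Type w) [AddCommGroup G] (n : ℕ) :
    AddSubgroup (Cochain U G n) :=
  (d U G n).ker ⊓ relCochains U A G n

/-- The relative coboundaries: coboundaries of relative cochains. -/
def relCoboundaries (U : Cover X) (A : Set X) (G : Type w) [AddCommGroup G] :
    (n : ℕ) → AddSubgroup (Cochain U G n)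
  | 0 => ⊥
  | n + 1 => (relCochains U A G n).map (d U G n)

/-- The coboundaries of the cochain complex augmented by `G`: in degree `0` these are
the constant cochains. -/
def redCoboundaries (U : Cover X) (G : Type w) [AddCommGroup G] :
    (n : ℕ) → AddSubgroup (Cochain U G n)
  | 0 => (Pi.constAddMonoidHom (Simplex U 0) G).range
  | n + 1 => (d U G n).range

/-- The homomorphism `Z / (B ∩ Z) → Z' / (B' ∩ Z')` induced by `φ`. -/
def subquotientMap {M : Type*} {N : Type*} [AddCommGroup M] [AddCommGroup N] (φ : M →+ N)
    {Z B : AddSubgroup M} {Z' B' : AddSubgroup N} (hZ : Z ≤ Z'.comap φ) (hB : B ≤ B'.comap φ) :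
    Z ⧸ B.addSubgroupOf Z →+ Z' ⧸ B'.addSubgroupOf Z' :=
  QuotientAddGroup.map _ _ ((φ.comp Z.subtype).codRestrict Z' fun z => hZ z.2) fun _ hz => hB hz

/-- The reduced cohomology of the nerve of `U`. -/
def NerveH (U : Cover X) (G : Type w) [AddCommGroup G] (n : ℕ) : Type (max u w) :=
  (d U G n).ker ⧸ (redCoboundaries U G n).addSubgroupOf (d U G n).ker

instance (U : Cover X) (n : ℕ) : AddCommGroup (NerveH U G n) :=
  inferInstanceAs (AddCommGroup ((d U G n).ker ⧸ (redCoboundaries U G n).addSubgroupOf _))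

/-- The cohomology of the nerve of `U` relative to the nerve over `A`. -/
def NerveRelH (U : Cover X) (A : Set X) (G : Type w) [AddCommGroup G] (n : ℕ) :
    Type (max u w) :=
  relCocycles U A G n ⧸ (relCoboundaries U A G n).addSubgroupOf (relCocycles U A G n)

instance (U : Cover X) (A : Set X) (n : ℕ) : AddCommGroup (NerveRelH U A G n) :=
  inferInstanceAs (AddCommGroup (relCocycles U A G n ⧸ (relCoboundaries U A G n).addSubgroupOf _))

lemma ker_d_le_comap {U : Cover Y} {V : Cover X} (f : C(X, Y)) (h : U.comap f ≤ V) (n : ℕ) :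
    (d U G n).ker ≤ (d V G n).ker.comap (pullback f h G n) := fun c hc => by
  rw [AddSubgroup.mem_comap, AddMonoidHom.mem_ker, d_pullback, AddMonoidHom.mem_ker.1 hc, map_zero]

lemma redCoboundaries_le_comap {U : Cover Y} {V : Cover X} (f : C(X, Y)) (h : U.comap f ≤ V)
    (n : ℕ) : redCoboundaries U G n ≤ (redCoboundaries V G n).comap (pullback f h G n) := by
  cases n with
  | zero => rintro _ ⟨g, rfl⟩; exact ⟨g, rfl⟩
  | succ n => rintro _ ⟨b, rfl⟩; exact ⟨pullback f h G n b, rfl⟩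

/-- The homomorphism of reduced cohomology of nerves induced by `f`. -/
def nerveMap {U : Cover Y} {V : Cover X} (f : C(X, Y)) (h : U.comap f ≤ V) (G : Type w)
    [AddCommGroup G] (n : ℕ) : NerveH U G n →+ NerveH V G n :=
  subquotientMap (pullback f h G n) (ker_d_le_comap f h n) (redCoboundaries_le_comap f h n)

lemma relCochains_le_comap {U V : Cover X} (A : Set X) (h : U ≤ V) (n : ℕ) :
    relCochains U A G n ≤ (relCochains V A G n).comap (pullback (.id X) h G n) :=
  fun _ hc _ hs => hc _ ⟨hs.1, hs.2.mono <| inter_subset_inter_left _ <|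
    iInter_mono fun _ => h _⟩

lemma relCocycles_le_comap {U V : Cover X} (A : Set X) (h : U ≤ V) (n : ℕ) :
    relCocycles U A G n ≤ (relCocycles V A G n).comap (pullback (.id X) h G n) :=
  fun _ hc => ⟨ker_d_le_comap (.id X) h n hc.1, relCochains_le_comap A h n hc.2⟩

lemma relCoboundaries_le_comap {U V : Cover X} (A : Set X) (h : U ≤ V) (n : ℕ) :
    relCoboundaries U A G n ≤ (relCoboundaries V A G n).comap (pullback (.id X) h G n) := by
  cases n with
  | zero => rintro _ rfl; exact map_zero _
  | succ n =>
    rintro _ ⟨b, hb, rfl⟩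
    exact ⟨pullback (.id X) h G n b, relCochains_le_comap A h n hb, rfl⟩

/-- The homomorphism of relative cohomology of nerves induced by a refinement. -/
def nerveRelMap {U V : Cover X} (A : Set X) (h : U ≤ V) (G : Type w) [AddCommGroup G] (n : ℕ) :
    NerveRelH U A G n →+ NerveRelH V A G n :=
  subquotientMap (pullback (.id X) h G n) (relCocycles_le_comap A h n)
    (relCoboundaries_le_comap A h n)

end Cochains

/-! ### Čech cohomology -/

/-- The Čech cohomology group `H^n(X; G)`, reduced in dimension zero: the direct limit over the
open covers of `X` of the (reduced) cohomology groups of their nerves. -/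
def H (X : Type u) [TopologicalSpace X] (G : Type w) [AddCommGroup G] (n : ℕ) :
    Type (max u w) :=
  AddCommGroup.DirectLimit (fun U : Cover X => NerveH U G n)
    fun _ _ h => nerveMap (.id X) h G n

instance (X : Type u) [TopologicalSpace X] (G : Type w) [AddCommGroup G] (n : ℕ) :
    AddCommGroup (H X G n) :=
  inferInstanceAs (AddCommGroup (AddCommGroup.DirectLimit _ _))

/-- The relative Čech cohomology group `H^n(X, A; G)`: the direct limit over the open covers of `X`
of the cohomology groups of the pairs of nerves. -/
def RelH (X : Type u) [TopologicalSpace X] (A : Set X) (G : Type w) [AddCommGroup G] (n : ℕ) :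
    Type (max u w) :=
  AddCommGroup.DirectLimit (fun U : Cover X => NerveRelH U A G n)
    fun _ _ h => nerveRelMap A h G n

instance (X : Type u) [TopologicalSpace X] (A : Set X) (G : Type w) [AddCommGroup G] (n : ℕ) :
    AddCommGroup (RelH X A G n) :=
  inferInstanceAs (AddCommGroup (AddCommGroup.DirectLimit _ _))

lemma comap_mono {X : Type u} [TopologicalSpace X] {Y : Type v} [TopologicalSpace Y] (f : C(X, Y))
    {U V : Cover Y} (h : U ≤ V) : U.comap f ≤ V.comap f := fun x _ hx => h (f x) hx

/-- The homomorphism `H^n(Y; G) → H^n(X; G)` induced by a continuous map `f : X → Y`. -/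
def map {X : Type u} [TopologicalSpace X] {Y : Type v} [TopologicalSpace Y] (f : C(X, Y))
    (G : Type w) [AddCommGroup G] (n : ℕ) : H Y G n →+ H X G n :=
  AddCommGroup.DirectLimit.lift _ _ _
    (fun U => (AddCommGroup.DirectLimit.of (fun V : Cover X => NerveH V G n)
      (fun _ _ h => nerveMap (.id X) h G n) (U.comap f)).comp (nerveMap f le_rfl G n))
    fun U V h z => by
      obtain ⟨c, rfl⟩ := QuotientAddGroup.mk_surjective z
      exact AddCommGroup.DirectLimit.of_f (f := fun _ _ h => nerveMap (.id X) h G n)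
        (comap_mono f h) (nerveMap f le_rfl G n (QuotientAddGroup.mk c))

/-- The homomorphism `j_{B,A} : H^n(B; G) → H^n(A; G)` induced by an inclusion `A ⊆ B`. -/
def restrict {X : Type u} [TopologicalSpace X] {A B : Set X} (h : A ⊆ B) (G : Type w)
    [AddCommGroup G] (n : ℕ) : H B G n →+ H A G n :=
  map ⟨inclusion h, continuous_inclusion h⟩ G n

/-- `γ ∈ H^n(A; G)` is extendable over `B ⊇ A`: it lies in the image of `H^n(B; G)`. -/
def IsExtendable {X : Type u} [TopologicalSpace X] {A B : Set X} (h : A ⊆ B) {G : Type w}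
    [AddCommGroup G] {n : ℕ} (γ : H A G n) : Prop :=
  γ ∈ (restrict h G n).range

end Cech

end

/-! This is the gluing half of a Mayer–Vietoris argument, run by contraposition. Suppose the
relative group of `C` vanishes, and represent the two extensions of `γ` by cocycles `c₁` over `P₁ ∪
A` and `c₂` over `P₂ ∪ A`. Over `A` they differ by a null cochain `e`. Then `c₁ - c₂ - e` is a
cocycle over `C` vanishing over `C ∩ A`, hence, by hypothesis, a null cochain `e'` that can be taken
to vanish over `A`. The corrected cocycle `c₁ - e - e'` agrees with `c₂` over both `A` and `C`, so
the two glue to a cocycle over `K` that restricts to `γ`.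

Cochains are functions on all tuples of `X`: restriction then changes only the tuples considered,
and null cochains are cocycles everywhere. The topology enters through refinements:
`exists_over_of_nonempty_iInter` moves common points into a given subset, and `Cover.Over.of_union`
splits simplices over a union of closed sets. -/

noncomputable section

namespace Cech

universe u w

/-! ### Cochains on tuples of an ambient space -/

section Tuples

variable {X : Type u} {G : Type w} [AddCommGroup G]

/-- The coboundary of a cochain defined on all tuples of points. -/
def cob {m : ℕ} (c : (Fin m → X) → G) (t : Fin (m + 1) → X) : G :=
  ∑ i : Fin (m + 1), (-1 : ℤ) ^ (i : ℕ) • c fun j => t (i.succAbove j)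

lemma cob_sub {m : ℕ} (c c' : (Fin m → X) → G) (t : Fin (m + 1) → X) :
    cob (fun s => c s - c' s) t = cob c t - cob c' t := by
  simp [cob, smul_sub, Finset.sum_sub_distrib]

lemma cob_congr {m : ℕ} {c c' : (Fin m → X) → G} {t : Fin (m + 1) → X}
    (h : ∀ i : Fin (m + 1), c (fun j => t (i.succAbove j)) = c' fun j => t (i.succAbove j)) :
    cob c t = cob c' t :=
  Finset.sum_congr rfl fun i _ => by rw [h i]

lemma cob_zero {m : ℕ} (t : Fin (m + 1) → X) : cob (fun _ => (0 : G)) t = 0 := by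
  simp [cob]

lemma cob_cob {m : ℕ} (b : (Fin m → X) → G) (t : Fin (m + 2) → X) : cob (cob b) t = 0 := by
  simp only [cob, Finset.smul_sum, smul_smul, ← pow_add]
  rw [← Finset.sum_product']
  refine Finset.sum_involution
    -- The involution swaps the two orders in which the same pair of vertices can be omitted; it
    -- reverses the sign.
    (fun p _ => (p.1.succAbove p.2, p.2.predAbove p.1)) ?_ ?_ (by simp) ?_
  · rintro ⟨i, j⟩ -
    simp only [Fin.succAbove_succAbove_succAbove_predAbove, Fin.neg_one_pow_succAbove_add_predAbove]
    simp
  · rintro ⟨i, j⟩ - - h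
    exact Fin.succAbove_ne i j (Prod.ext_iff.1 h).1
  · rintro ⟨i, j⟩ -
    simp [Fin.succAbove_succAbove_predAbove, Fin.predAbove_predAbove_succAbove]

lemma cob_const (g : G) (t : Fin 2 → X) : cob (fun _ => g) t = 0 := by
  simp [cob, Fin.sum_univ_two]

/-- The cochains that represent zero in reduced cohomology for every cover: coboundaries, and in
degree zero the constants. -/
def IsNull : (m : ℕ) → ((Fin (m + 1) → X) → G) → Prop
  | 0, e => ∃ g, e = fun _ => g
  | _ + 1, e => ∃ b, e = cob b

lemma IsNull.cob_eq_zero {m : ℕ} {e : (Fin (m + 1) → X) → G} (he : IsNull m e)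
    (t : Fin (m + 2) → X) : cob e t = 0 := by
  cases m with
  | zero => obtain ⟨g, rfl⟩ := he; exact cob_const g t
  | succ m => obtain ⟨b, rfl⟩ := he; exact cob_cob b t

end Tuples

/-! ### Covers of a subspace induced from the ambient space -/

section Over

variable {X : Type u} [TopologicalSpace X] {G : Type w} [AddCommGroup G]

/-- The cover of the subspace `S` induced by a cover of the ambient space. -/
abbrev Cover.res (U : Cover X) (S : Set X) : Cover S :=
  U.comap ⟨Subtype.val, continuous_subtype_val⟩

/-- The tuple `t` is a simplex of the nerve of the cover of `S` induced by `U`. -/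
def Cover.Over (U : Cover X) (S : Set X) {k : ℕ} (t : Fin k → X) : Prop :=
  (∀ i, t i ∈ S) ∧ ((⋂ i, U.nhd (t i)) ∩ S).Nonempty

lemma Cover.Over.mono_set {U : Cover X} {S T : Set X} (h : S ⊆ T) {k : ℕ} {t : Fin k → X}
    (ht : U.Over S t) : U.Over T t :=
  ⟨fun i => h (ht.1 i), ht.2.mono (inter_subset_inter_right _ h)⟩

lemma Cover.Over.mono_cover {U V : Cover X} (h : U ≤ V) {S : Set X} {k : ℕ} {t : Fin k → X}
    (ht : V.Over S t) : U.Over S t :=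
  ⟨ht.1, ht.2.mono (inter_subset_inter_left _ (iInter_mono fun i => h (t i)))⟩

lemma Cover.Over.face {U : Cover X} {S : Set X} {k : ℕ} {t : Fin (k + 1) → X}
    (ht : U.Over S t) (i : Fin (k + 1)) : U.Over S fun j => t (i.succAbove j) :=
  ⟨fun _ => ht.1 _, ht.2.mono (inter_subset_inter_left _ fun _ hx =>
    mem_iInter.2 fun j => mem_iInter.1 hx (i.succAbove j))⟩

lemma Cover.over_simplex {U : Cover X} {S : Set X} {m : ℕ} (s : Simplex (U.res S) m) :
    U.Over S fun i => (s.1 i : X) :=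
  ⟨fun i => (s.1 i).2, s.2.elim fun x hx => ⟨x, mem_iInter.2 fun i => mem_iInter.1 hx i, x.2⟩⟩

/-- The simplex of the nerve over `S` given by a tuple. -/
def Cover.Over.simplex {U : Cover X} {S : Set X} {m : ℕ} {t : Fin (m + 1) → X}
    (ht : U.Over S t) : Simplex (U.res S) m :=
  ⟨fun i => ⟨t i, ht.1 i⟩, ht.2.elim fun x hx => ⟨⟨x, hx.2⟩, mem_iInter.2 fun i =>
    mem_iInter.1 hx.1 i⟩⟩

/-- The cochain of the nerve over `S` given by a function on tuples. -/
def toCochain (U : Cover X) (S : Set X) {m : ℕ} (c : (Fin (m + 1) → X) → G) :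
    Cochain (U.res S) G m :=
  fun s => c fun i => (s.1 i : X)

lemma toCochain_surjective (U : Cover X) (S : Set X) {m : ℕ} (c' : Cochain (U.res S) G m) :
    ∃ c, toCochain U S c = c' := by
  classical
  refine ⟨fun t => if h : U.Over S t then c' h.simplex else 0, funext fun s => ?_⟩
  simp only [toCochain, dif_pos (Cover.over_simplex s)]
  rfl

lemma d_toCochain (U : Cover X) (S : Set X) {m : ℕ} (c : (Fin (m + 1) → X) → G) :
    d (U.res S) G m (toCochain U S c) = toCochain U S (cob c) := rfl

lemma toCochain_eq_iff {U : Cover X} {S : Set X} {m : ℕ} {c c' : (Fin (m + 1) → X) → G} :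
    toCochain U S c = toCochain U S c' ↔ ∀ t, U.Over S t → c t = c' t :=
  ⟨fun h _ ht => congrFun h ht.simplex, fun h => funext fun s => h _ (Cover.over_simplex s)⟩

lemma toCochain_mem_ker_iff {U : Cover X} {S : Set X} {m : ℕ} {c : (Fin (m + 1) → X) → G} :
    toCochain U S c ∈ (d (U.res S) G m).ker ↔ ∀ t, U.Over S t → cob c t = 0 := by
  rw [AddMonoidHom.mem_ker, d_toCochain]
  exact toCochain_eq_iff (c' := fun _ => 0)

/-- Induced covers are cofinal among the covers of `S`, so the limit for any subspace can be
computed with covers of `X`, and several subspaces can share one cover. -/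
lemma exists_le_res (S : Set X) (V : Cover S) (U₀ : Cover X) :
    ∃ U : Cover X, U₀ ≤ U ∧ V ≤ U.res S := by
  classical
  choose O hO hOV using fun x : S => isOpen_induced_iff.1 (V.isOpen_nhd x)
  refine ⟨⟨fun x => U₀.nhd x ∩ if h : x ∈ S then O ⟨x, h⟩ else univ, fun x => ?_, fun x => ?_⟩,
    fun x => inter_subset_left, fun x y hy => ?_⟩
  · refine (U₀.isOpen_nhd x).inter ?_
    split_ifs with h
    exacts [hO _, isOpen_univ]
  · refine ⟨U₀.mem_nhd x, ?_⟩
    split_ifs with h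
    · have := V.mem_nhd ⟨x, h⟩
      rwa [← hOV] at this
    · trivial
  · rw [← hOV]
    have := hy.2
    simpa using this

lemma res_mono {U V : Cover X} (h : U ≤ V) (S : Set X) : U.res S ≤ V.res S :=
  comap_mono _ h

end Over

/-! ### Cohomology classes of tuple cochains -/

section Classes

variable {X : Type u} [TopologicalSpace X] {G : Type w} [AddCommGroup G]

instance (Y : Type u) [TopologicalSpace Y] (m : ℕ) :
    DirectedSystem (fun U : Cover Y => NerveH U G m) fun _ _ h => nerveMap (.id Y) h G m where
  map_self _ x := by obtain ⟨c, rfl⟩ := QuotientAddGroup.mk_surjective x; rfl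
  map_map _ _ _ _ _ x := by obtain ⟨c, rfl⟩ := QuotientAddGroup.mk_surjective x; rfl

instance (Y : Type u) [TopologicalSpace Y] (A : Set Y) (m : ℕ) :
    DirectedSystem (fun U : Cover Y => NerveRelH U A G m) fun _ _ h => nerveRelMap A h G m where
  map_self _ x := by obtain ⟨c, rfl⟩ := QuotientAddGroup.mk_surjective x; rfl
  map_map _ _ _ _ _ x := by obtain ⟨c, rfl⟩ := QuotientAddGroup.mk_surjective x; rfl

/-- The class in the cohomology of the nerve of a cocycle. -/
def nerveCls {Y : Type u} [TopologicalSpace Y] (V : Cover Y) {m : ℕ} (c : Cochain V G m)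
    (hc : c ∈ (d V G m).ker) : NerveH V G m :=
  (QuotientAddGroup.mk (⟨c, hc⟩ : (d V G m).ker) :
    (d V G m).ker ⧸ (redCoboundaries V G m).addSubgroupOf (d V G m).ker)

lemma nerveCls_eq_zero_iff {Y : Type u} [TopologicalSpace Y] {V : Cover Y} {m : ℕ}
    {c : Cochain V G m} {hc : c ∈ (d V G m).ker} :
    nerveCls V c hc = 0 ↔ c ∈ redCoboundaries V G m :=
  (QuotientAddGroup.eq_zero_iff _).trans AddSubgroup.mem_addSubgroupOf

/-- The class in Čech cohomology of a cocycle of the nerve. -/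
def cechCls {Y : Type u} [TopologicalSpace Y] (V : Cover Y) {m : ℕ} (c : Cochain V G m)
    (hc : c ∈ (d V G m).ker) : H Y G m :=
  AddCommGroup.DirectLimit.of (fun V : Cover Y => NerveH V G m)
    (fun _ _ h => nerveMap (.id Y) h G m) V (nerveCls V c hc)

lemma cechCls_pullback {Y : Type u} [TopologicalSpace Y] {V W : Cover Y} (h : V ≤ W) {m : ℕ}
    {c : Cochain V G m} (hc : c ∈ (d V G m).ker) :
    cechCls W (pullback (.id Y) h G m c) (ker_d_le_comap _ h m hc) = cechCls V c hc :=
  AddCommGroup.DirectLimit.of_f (f := fun _ _ h => nerveMap (.id Y) h G m) h (nerveCls V c hc)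

lemma exists_cechCls {Y : Type u} [TopologicalSpace Y] {m : ℕ} (z : H Y G m) :
    ∃ (V : Cover Y) (c : Cochain V G m) (hc : c ∈ (d V G m).ker), cechCls V c hc = z := by
  refine AddCommGroup.DirectLimit.induction_on (C := fun z : H Y G m =>
    ∃ (V : Cover Y) (c : Cochain V G m) (hc : c ∈ (d V G m).ker), cechCls V c hc = z) z
    fun V x => ?_
  obtain ⟨c, rfl⟩ := QuotientAddGroup.mk_surjective x
  exact ⟨V, c.1, c.2, rfl⟩

lemma cechCls_eq_zero {Y : Type u} [TopologicalSpace Y] {V : Cover Y} {m : ℕ} {c : Cochain V G m}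
    {hc : c ∈ (d V G m).ker} (h : cechCls V c hc = 0) :
    ∃ (W : Cover Y) (hVW : V ≤ W), pullback (.id Y) hVW G m c ∈ redCoboundaries W G m := by
  obtain ⟨W, hVW, h'⟩ := AddCommGroup.DirectLimit.of.zero_exact _ _ h
  exact ⟨W, hVW, nerveCls_eq_zero_iff.1 h'⟩

/-- The class in `H^m(S; G)` of a cochain on tuples which is a cocycle over `S`. -/
def cls (U : Cover X) (S : Set X) {m : ℕ} (c : (Fin (m + 1) → X) → G)
    (hc : ∀ t, U.Over S t → cob c t = 0) : H S G m :=
  cechCls (U.res S) (toCochain U S c) (toCochain_mem_ker_iff.2 hc)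

lemma cls_refine {U V : Cover X} (h : U ≤ V) {S : Set X} {m : ℕ} {c : (Fin (m + 1) → X) → G}
    (hc : ∀ t, U.Over S t → cob c t = 0) :
    cls V S c (fun t ht => hc t (ht.mono_cover h)) = cls U S c hc :=
  cechCls_pullback (res_mono h S) (toCochain_mem_ker_iff.2 hc)

lemma cls_congr {U : Cover X} {S : Set X} {m : ℕ} {c c' : (Fin (m + 1) → X) → G}
    (hc : ∀ t, U.Over S t → cob c t = 0) (h : ∀ t, U.Over S t → c t = c' t) :
    cls U S c' (fun t ht => (cob_congr fun i => (h _ (ht.face i)).symm).trans (hc t ht)) =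
      cls U S c hc := by
  have : toCochain U S c' = toCochain U S c := toCochain_eq_iff.2 fun t ht => (h t ht).symm
  simp only [cls, this]

lemma cls_sub {U : Cover X} {S : Set X} {m : ℕ} {c c' : (Fin (m + 1) → X) → G}
    (hc : ∀ t, U.Over S t → cob c t = 0) (hc' : ∀ t, U.Over S t → cob c' t = 0) :
    cls U S (fun t => c t - c' t)
      (fun t ht => by rw [cob_sub, hc t ht, hc' t ht, sub_zero]) = cls U S c hc - cls U S c' hc' :=
  map_sub (AddCommGroup.DirectLimit.of (fun V : Cover S => NerveH V G m)
    (fun _ _ h => nerveMap (.id S) h G m) (U.res S)) (nerveCls _ (toCochain U S c) _)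
      (nerveCls _ (toCochain U S c') _)

lemma restrict_cls {U : Cover X} {S T : Set X} (h : T ⊆ S) {m : ℕ} {c : (Fin (m + 1) → X) → G}
    (hc : ∀ t, U.Over S t → cob c t = 0) :
    restrict h G m (cls U S c hc) = cls U T c (fun t ht => hc t (ht.mono_set h)) :=
  AddCommGroup.DirectLimit.lift_of _ _ _ _ _

lemma exists_cls {S : Set X} {m : ℕ} (z : H S G m) (U₀ : Cover X) :
    ∃ U, U₀ ≤ U ∧ ∃ (c : (Fin (m + 1) → X) → G) (hc : ∀ t, U.Over S t → cob c t = 0),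
      cls U S c hc = z := by
  obtain ⟨V, c', hc', rfl⟩ := exists_cechCls z
  obtain ⟨U, hU, hV⟩ := exists_le_res S V U₀
  obtain ⟨c, hc⟩ := toCochain_surjective U S (pullback (.id S) hV G m c')
  have hk := ker_d_le_comap (.id S) hV m hc'
  rw [AddSubgroup.mem_comap, ← hc] at hk
  refine ⟨U, hU, c, toCochain_mem_ker_iff.1 hk, ?_⟩
  rw [← cechCls_pullback hV hc']
  simp only [cls, hc]

/-- A class that is zero in the limit dies on some refinement. Extending the bounding cochain by
zero to all tuples is harmless, since every face of a simplex over `S` is again over `S`. -/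
lemma exists_isNull_of_cls_eq_zero {U : Cover X} {S : Set X} {m : ℕ}
    {c : (Fin (m + 1) → X) → G} {hc : ∀ t, U.Over S t → cob c t = 0} (h : cls U S c hc = 0) :
    ∃ V, U ≤ V ∧ ∃ e, IsNull m e ∧ ∀ t, V.Over S t → c t = e t := by
  obtain ⟨W, hW, hcW⟩ := cechCls_eq_zero h
  obtain ⟨V, hUV, hWV⟩ := exists_le_res S W U
  have hcV := redCoboundaries_le_comap (.id S) hWV m hcW
  refine ⟨V, hUV, ?_⟩
  cases m with
  | zero =>
    obtain ⟨g, hg⟩ := hcV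
    exact ⟨fun _ => g, ⟨g, rfl⟩, fun t ht => (congrFun hg ht.simplex).symm⟩
  | succ m =>
    obtain ⟨b', hb⟩ := hcV
    obtain ⟨b, rfl⟩ := toCochain_surjective V S b'
    exact ⟨cob b, ⟨b, rfl⟩, fun t ht => (congrFun hb ht.simplex).symm⟩

lemma exists_mem_relCoboundaries {Y : Type u} [TopologicalSpace Y] {A : Set Y} {m : ℕ}
    [Subsingleton (RelH Y A G m)] {V : Cover Y} {c : Cochain V G m} (hc : c ∈ relCocycles V A G m) :
    ∃ (W : Cover Y) (hVW : V ≤ W), pullback (.id Y) hVW G m c ∈ relCoboundaries W A G m := by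
  have h : AddCommGroup.DirectLimit.of (fun V : Cover Y => NerveRelH V A G m)
      (fun _ _ h => nerveRelMap A h G m) V (QuotientAddGroup.mk ⟨c, hc⟩ :
        relCocycles V A G m ⧸ (relCoboundaries V A G m).addSubgroupOf (relCocycles V A G m)) = 0 :=
    Subsingleton.elim (α := RelH Y A G m) _ _
  obtain ⟨W, hVW, h'⟩ := AddCommGroup.DirectLimit.of.zero_exact _ _ h
  exact ⟨W, hVW, AddSubgroup.mem_addSubgroupOf.1 ((QuotientAddGroup.eq_zero_iff _).1 h')⟩

end Classes

/-! ### Covers adapted to closed subsets -/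

section Adapted

variable {X : Type u} [TopologicalSpace X]

/-- If the sets `U.nhd (t i)` had no common point in `D`, the sets `D \ U.nhd (t i)` would cover
`D`, and the distance from any `x` to `D` would equal its distance to one of them. The refinement
excludes such `x`. -/
lemma exists_over_of_nonempty_iInter [TopologicalSpace.MetrizableSpace X] (U : Cover X)
    (D : Set X) : ∃ V, U ≤ V ∧ ∀ (k : ℕ) (t : Fin (k + 1) → X), (∀ i, t i ∈ D) →
      (⋂ i, V.nhd (t i)).Nonempty → U.Over D t := by
  classical
  let _ := TopologicalSpace.metrizableSpaceMetric X
  -- For open `O`, this is an open set of `X` with the same trace on `D` as `O`.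
  let E : Set X → Set X := fun O => {x | Metric.infEDist x D < Metric.infEDist x (D \ O)}
  refine ⟨⟨fun x => U.nhd x ∩ if x ∈ D then E (U.nhd x) else univ, fun x => ?_, fun x => ?_⟩,
    fun x => inter_subset_left, fun k t ht h => ⟨ht, ?_⟩⟩
  · refine (U.isOpen_nhd x).inter ?_
    split_ifs with h
    exacts [isOpen_lt Metric.continuous_infEDist Metric.continuous_infEDist, isOpen_univ]
  · refine ⟨U.mem_nhd x, ?_⟩
    split_ifs with h
    · change Metric.infEDist x D < _
      rw [Metric.infEDist_zero_of_mem h, Metric.infEDist_pos_iff_notMem_closure]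
      intro hx
      obtain ⟨y, hy, hy'⟩ := mem_closure_iff.1 hx _ (U.isOpen_nhd x) (U.mem_nhd x)
      exact hy'.2 hy
    · trivial
  · obtain ⟨x, hx⟩ := h
    have hx' : ∀ i, Metric.infEDist x D < Metric.infEDist x (D \ U.nhd (t i)) := fun i => by
      have := (mem_iInter.1 hx i).2
      rwa [if_pos (ht i)] at this
    by_contra hne
    have hD : D ⊆ ⋃ i, D \ U.nhd (t i) := fun y hy => by
      by_contra hy'
      simp only [mem_iUnion, mem_sdiff, hy, true_and, not_exists, not_not] at hy'
      exact hne ⟨y, mem_iInter.2 hy', hy⟩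
    have hle := Metric.infEDist_anti (x := x) hD
    rw [Metric.infEDist_iUnion] at hle
    obtain ⟨i, hi⟩ := exists_eq_ciInf_of_finite (f := fun i => Metric.infEDist x (D \ U.nhd (t i)))
    exact (hx' i).not_ge (hi.trans_le hle)

/-- The members of `U` with index outside `E` do not meet `E`. -/
def Cover.Avoids (U : Cover X) (E : Set X) : Prop := ∀ x ∉ E, Disjoint (U.nhd x) E

lemma Cover.Avoids.mono {U V : Cover X} (h : U ≤ V) {E : Set X} (hU : U.Avoids E) : V.Avoids E :=
  fun x hx => (hU x hx).mono_left (h x)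

lemma exists_avoids (U : Cover X) {E : Set X} (hE : IsClosed E) : ∃ V, U ≤ V ∧ V.Avoids E := by
  classical
  refine ⟨⟨fun x => U.nhd x ∩ if x ∈ E then univ else Eᶜ, fun x => ?_, fun x => ?_⟩,
    fun x => inter_subset_left, fun x hx => ?_⟩
  · refine (U.isOpen_nhd x).inter ?_
    split_ifs
    exacts [isOpen_univ, hE.isOpen_compl]
  · refine ⟨U.mem_nhd x, ?_⟩
    split_ifs with h
    exacts [trivial, h]
  · simp only [if_neg hx]
    exact disjoint_compl_left.mono_left inter_subset_right

lemma Cover.Avoids.mem {U : Cover X} {E : Set X} (h : U.Avoids E) {x y : X} (hy : y ∈ U.nhd x)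
    (hyE : y ∈ E) : x ∈ E := by
  by_contra hx
  exact disjoint_left.1 (h x hx) hy hyE

/-- A common point lying in `E` forces every vertex into `E`, and likewise for `F`. -/
lemma Cover.Over.of_union {U : Cover X} {E F : Set X} (hE : U.Avoids E) (hF : U.Avoids F) {k : ℕ}
    {t : Fin k → X} (ht : U.Over (E ∪ F) t) : U.Over E t ∨ U.Over F t := by
  obtain ⟨-, y, hy, hyE | hyF⟩ := ht
  · exact Or.inl ⟨fun i => hE.mem (mem_iInter.1 hy i) hyE, y, hy, hyE⟩
  · exact Or.inr ⟨fun i => hF.mem (mem_iInter.1 hy i) hyF, y, hy, hyF⟩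

end Adapted

/-! ### Excision and gluing -/

section Gluing

variable {X : Type u} [TopologicalSpace X] [TopologicalSpace.MetrizableSpace X]
  {G : Type w} [AddCommGroup G]

/-- If `H^m(C, C ∩ A; G) = 0`, a cocycle over `C` that vanishes over `C ∩ A` agrees over `C`, after
a refinement, with a null cochain that vanishes over `A`. -/
lemma exists_isNull_of_subsingleton_relH {C A : Set X} {m : ℕ}
    [Subsingleton (RelH C (Subtype.val ⁻¹' (C ∩ A) : Set C) G m)] {U : Cover X}
    {c : (Fin (m + 1) → X) → G} (hc : ∀ t, U.Over C t → cob c t = 0)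
    (hcA : ∀ t, U.Over (C ∩ A) t → c t = 0) :
    ∃ V, U ≤ V ∧ ∃ e, IsNull m e ∧ (∀ t, V.Over C t → c t = e t) ∧ ∀ t, V.Over A t → e t = 0 := by
  classical
  have hrel : toCochain U C c ∈
      relCocycles (U.res C) (Subtype.val ⁻¹' (C ∩ A) : Set C) G m := by
    refine ⟨toCochain_mem_ker_iff.2 hc, fun s hs => hcA _ ⟨hs.1, ?_⟩⟩
    obtain ⟨y, hy, hyA⟩ := hs.2
    exact ⟨y, mem_iInter.2 fun i => mem_iInter.1 hy i, hyA⟩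
  obtain ⟨W, hW, hcW⟩ := exists_mem_relCoboundaries hrel
  obtain ⟨V, hUV, hWV⟩ := exists_le_res C W U
  have hcV := relCoboundaries_le_comap _ hWV m hcW
  cases m with
  | zero =>
    -- In degree zero the only relative coboundary is zero, so no constant appears.
    exact ⟨V, hUV, fun _ => 0, ⟨0, rfl⟩, fun t ht => congrFun hcV ht.simplex, fun _ _ => rfl⟩
  | succ m =>
    obtain ⟨b', hbA, hb⟩ := hcV
    obtain ⟨b, rfl⟩ := toCochain_surjective V C b'
    obtain ⟨V', hV', hD⟩ := exists_over_of_nonempty_iInter V (C ∩ A)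
    -- Cutting `b` off outside `C` makes its coboundary vanish over `A`: a face that is over both
    -- `C` and `A` has vertices in `C ∩ A`, and `hD` supplies a common point there, where `b` is
    -- zero.
    refine ⟨V', hUV.trans hV', cob fun t => if V'.Over C t then b t else 0, ⟨_, rfl⟩,
      fun t ht => ?_, fun t ht => ?_⟩
    · refine (congrFun hb (ht.mono_cover hV').simplex).symm.trans (cob_congr fun i => ?_)
      rw [if_pos (ht.face i)]
    · refine (cob_congr fun i => ?_).trans (cob_zero t)
      split_ifs with h
      · have h' := hD m _ (fun j => ⟨h.1 j, (ht.face i).1 j⟩) (h.2.mono inter_subset_left)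
        have h'' := h'.mono_set (inter_subset_left (s := C) (t := A))
        refine hbA h''.simplex ⟨h'.1, ?_⟩
        obtain ⟨y, hy, hyA⟩ := h'.2
        exact ⟨⟨y, hyA.1⟩, mem_iInter.2 fun j => mem_iInter.1 hy j, hyA⟩
      · rfl

/-- Cocycles over `P ∪ A` and `Q ∪ A` that agree over `A` and over `P ∩ Q` glue to a cocycle over
`P ∪ Q`, after a refinement. -/
lemma exists_glue {P Q A : Set X} (hP : IsClosed P) (hQ : IsClosed Q) (hA : IsClosed A) {m : ℕ}
    {U : Cover X} {c₁ c₂ : (Fin (m + 1) → X) → G}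
    (h₁ : ∀ t, U.Over (P ∪ A) t → cob c₁ t = 0) (h₂ : ∀ t, U.Over (Q ∪ A) t → cob c₂ t = 0)
    (hA' : ∀ t, U.Over A t → c₁ t = c₂ t) (hPQ : ∀ t, U.Over (P ∩ Q) t → c₁ t = c₂ t) :
    ∃ V, U ≤ V ∧ ∃ c : (Fin (m + 1) → X) → G, (∀ t, V.Over (P ∪ Q) t → cob c t = 0) ∧
      ∀ t, V.Over A t → c t = c₁ t := by
  classical
  obtain ⟨U₁, hU₁, ha⟩ := exists_avoids U hA
  obtain ⟨U₂, hU₂, hpq⟩ := exists_avoids U₁ (hP.inter hQ)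
  obtain ⟨U₃, hU₃, hp⟩ := exists_avoids U₂ hP
  obtain ⟨U₄, hU₄, hq⟩ := exists_avoids U₃ hQ
  obtain ⟨V, hV, hD⟩ := exists_over_of_nonempty_iInter U₄ (P ∩ Q ∪ A)
  have h4 : U₂ ≤ U₄ := hU₃.trans hU₄
  have hU : U ≤ U₄ := (hU₁.trans hU₂).trans h4
  -- The two common points may differ, but all vertices lie in `P ∩ Q ∪ A`, so `hD` gives a common
  -- point in that set.
  have hagree : ∀ t : Fin (m + 1) → X, V.Over (P ∪ A) t → V.Over (Q ∪ A) t → c₁ t = c₂ t := by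
    intro t ht ht'
    have := hD m t (fun i => by
      rcases ht.1 i with h | h
      · exact (ht'.1 i).imp (fun h' => ⟨h, h'⟩) id
      · exact Or.inr h) (ht.2.mono inter_subset_left)
    rcases this.of_union (hpq.mono h4) (ha.mono (hU₂.trans h4)) with h | h
    · exact hPQ t (h.mono_cover hU)
    · exact hA' t (h.mono_cover hU)
  refine ⟨V, hU.trans hV, fun t => if V.Over (P ∪ A) t then c₁ t else c₂ t,
    fun t ht => ?_, fun t ht => if_pos (ht.mono_set subset_union_right)⟩
  rcases ht.of_union (hp.mono (hU₄.trans hV)) (hq.mono hV) with h | h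
  · have h := h.mono_set (subset_union_left (t := A))
    rw [← h₁ t (h.mono_cover (hU.trans hV))]
    exact cob_congr fun i => if_pos (h.face i)
  · have h := h.mono_set (subset_union_left (t := A))
    rw [← h₂ t (h.mono_cover (hU.trans hV))]
    -- A face of a simplex over `Q` may also be over `P ∪ A`, where the glued cochain takes the
    -- value of `c₁`.
    refine cob_congr fun i => ?_
    split_ifs with h'
    exacts [hagree _ h' (h.face i), rfl]

/-- If `H^m(P ∩ Q, P ∩ Q ∩ A; G) = 0`, a class of `A` that extends over `P ∪ A` and over `Q ∪ A`
extends over `P ∪ Q`. -/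
theorem isExtendable_union {P Q A : Set X} (hP : IsClosed P) (hQ : IsClosed Q) (hA : IsClosed A)
    (hAPQ : A ⊆ P ∪ Q) {m : ℕ}
    [Subsingleton (RelH ↥(P ∩ Q) (Subtype.val ⁻¹' (P ∩ Q ∩ A) : Set ↥(P ∩ Q)) G m)] {γ : H A G m}
    (hγ₁ : IsExtendable (subset_union_right : A ⊆ P ∪ A) γ)
    (hγ₂ : IsExtendable (subset_union_right : A ⊆ Q ∪ A) γ) : IsExtendable hAPQ γ := by
  obtain ⟨z₁, hz₁⟩ := hγ₁
  obtain ⟨z₂, rfl⟩ := hγ₂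
  obtain ⟨U₁, -, c₁, hc₁, rfl⟩ := exists_cls z₁ (Classical.arbitrary _)
  obtain ⟨U₂, hU₁₂, c₂, hc₂, rfl⟩ := exists_cls z₂ U₁
  rw [← cls_refine hU₁₂ hc₁, restrict_cls, restrict_cls, ← sub_eq_zero, ← cls_sub] at hz₁
  obtain ⟨U₃, hU₂₃, e, he, hce⟩ := exists_isNull_of_cls_eq_zero hz₁
  have hU₁₃ := hU₁₂.trans hU₂₃
  -- Subtracting `e` makes the difference vanish over `P ∩ Q ∩ A`, so it defines a relative class.
  obtain ⟨U₄, hU₃₄, e', he', hce', heA⟩ :=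
    exists_isNull_of_subsingleton_relH (C := P ∩ Q) (A := A) (U := U₃)
      (c := fun t => (c₁ t - c₂ t) - e t)
      (fun t ht => by
        rw [cob_sub, cob_sub, he.cob_eq_zero,
          hc₁ t ((ht.mono_cover hU₁₃).mono_set (inter_subset_left.trans subset_union_left)),
          hc₂ t ((ht.mono_cover hU₂₃).mono_set (inter_subset_right.trans subset_union_left))]
        simp)
      (fun t ht => by rw [hce t (ht.mono_set inter_subset_right), sub_self])
  have hU₁₄ := hU₁₃.trans hU₃₄
  have hU₂₄ := hU₂₃.trans hU₃₄
  have h₁ : ∀ t, U₄.Over (P ∪ A) t → cob (fun t => c₁ t - e t - e' t) t = 0 := fun t ht => by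
    rw [cob_sub, cob_sub, hc₁ t (ht.mono_cover hU₁₄), he.cob_eq_zero, he'.cob_eq_zero]
    simp
  have h₂ : ∀ t, U₄.Over (Q ∪ A) t → cob c₂ t = 0 := fun t ht => hc₂ t (ht.mono_cover hU₂₄)
  have hA₁₂ : ∀ t, U₄.Over A t → c₁ t - e t - e' t = c₂ t := fun t ht => by
    rw [heA t ht, ← hce t (ht.mono_cover hU₃₄)]
    simp
  obtain ⟨V, hV, c, hc, hcA⟩ := exists_glue hP hQ hA h₁ h₂ hA₁₂ fun t ht => by
    rw [← hce' t ht]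
    simp
  refine ⟨cls V (P ∪ Q) c hc, ?_⟩
  have hA₂ : ∀ t, V.Over A t → cob c₂ t = 0 := fun t ht =>
    h₂ t ((ht.mono_cover hV).mono_set subset_union_right)
  rw [← cls_refine (hU₂₄.trans hV) hc₂, restrict_cls, restrict_cls]
  exact cls_congr hA₂ fun t ht => ((hcA t ht).trans (hA₁₂ t (ht.mono_cover hV))).symm

end Gluing

end Cech

end

theorem proposition2p3 {X : Type*} [TopologicalSpace X] [TopologicalSpace.MetrizableSpace X]
    {G : Type*} [AddCommGroup G] (n : ℕ) (hn : 1 ≤ n) (K A P₁ P₂ C : Set X)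
    (hK : IsCompact K) (hA : IsCompact A) (hAK : A ⊆ K)
    (γ : Cech.H A G (n - 1)) (hγ : γ ≠ 0)
    (hP₁ : IsClosed P₁) (hP₂ : IsClosed P₂) (hP : P₁ ∪ P₂ = K)
    (hC : P₁ ∩ P₂ = C) (hC' : C.Nonempty)
    (hγ₁ : Cech.IsExtendable (subset_union_right : A ⊆ P₁ ∪ A) γ)
    (hγ₂ : Cech.IsExtendable (subset_union_right : A ⊆ P₂ ∪ A) γ)
    (hγK : ¬ Cech.IsExtendable hAK γ) :
    Nontrivial (Cech.RelH C (Subtype.val ⁻¹' (C ∩ A) : Set C) G (n - 1)) := by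
  subst hP hC
  by_contra h
  have := not_nontrivial_iff_subsingleton.1 h
  exact hγK (Cech.isExtendable_union hP₁ hP₂ hA.isClosed hAK hγ₁ hγ₂)
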